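/- Let $q \ge 2$ be a real number. There exists a constant $C = C(q) > 0$, depending only on $q$, with the following property. Let $n \in \mathbb{N}$, let $(E_i, \mathcal{E}_i)_{i=1}^n$ be measurable spaces and let $E = \prod_{i=1}^n E_i$ carry the product $\sigma$-algebra. Let $f : E \to \mathbb{R}$ and $g_i : E \to [0,\infty]$, $i = 1, \ldots, n$, be measurable functions such that, for every $i \in \{1, \ldots, n\}$ and all $x, x' \in E$ with $x_j = x'_j$ for every $j \neq i$, \[ |f(x) - f(x')| \le g_i(x) + g_i(x'). \] Let $X = (X_i)_{i=1}^n$ be independent random variables on a probability space $\Omega$, with $X_i : \Omega \to E_i$. If $\sum_{i=1}^n \mathbb{E}[g_i(X)^q] < \infty$, then $f(X)$ is integrable and \[ \mathbb{E}\big[\, |f(X) - \mathbb{E}[f(X)]|^q \,\big] \le C(q)\, n^{q/2-1} \sum_{i=1}^n \mathbb{E}\big[ g_i(X)^q \big]. \] (If the sum on the right is infinite, the right-hand side is $+\infty$ and the inequality holds trivially.) -/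

import Mathlib

open MeasureTheory ProbabilityTheory
open scoped ENNReal

/-! Coordinates are integrated out one at a time. With `h` the average of `f` over one coordinate
and `m` the mean, put `a = h - m` and `b = f - h`. Expanding `|a + b| ^ q` to first order in `b`
gives a cross term that integrates to zero, since `b` is centred given the other coordinates. The
difference hypothesis gives `E|b|^q ≤ 2^q E g^q`, and `h` inherits it with averaged `g i`, whose
`q`-th moments do not grow by Jensen. The exponent of `n` comes from `abs_add_rpow_le_of_one_le`
with `N = n`: each step multiplies `E|a|^q` by only `1 + K/n`, so `n` steps cost at most `exp K`,
while the `b` term pays `n ^ (q/2 - 1)`. -/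

/-! ### Scalar inequalities -/

/-- Convexity: the tangent to `x ^ p` at `1 + t` lies below the graph at `x = 1`. -/
theorem one_add_rpow_le_tangent {p t : ℝ} (hp : 1 ≤ p) (ht : -1 ≤ t) :
    (1 + t) ^ p ≤ 1 + p * t * (1 + t) ^ (p - 1) := by
  rcases ht.eq_or_lt with rfl | ht
  · rcases hp.eq_or_lt with rfl | hp
    · norm_num
    · have h1 : p - 1 ≠ 0 := by linarith
      have h2 : p ≠ 0 := by linarith
      simp [Real.zero_rpow h1, Real.zero_rpow h2]
  have h0 : 0 < 1 + t := by linarith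
  have hb := one_add_mul_self_le_rpow_one_add (s := (1 + t)⁻¹ - 1)
    (by have := inv_pos.2 h0; linarith) hp
  rw [add_sub_cancel, Real.inv_rpow h0.le] at hb
  have hpos : 0 < (1 + t) ^ p := Real.rpow_pos_of_pos h0 p
  have hm := mul_le_mul_of_nonneg_right hb hpos.le
  rw [inv_mul_cancel₀ hpos.ne'] at hm
  have hinv : (1 + t) ^ (p - 1) = (1 + t)⁻¹ * (1 + t) ^ p := by
    rw [Real.rpow_sub_one h0.ne']; ring
  have ht' : (1 + t)⁻¹ - 1 = - (t * (1 + t)⁻¹) := by field_simp; ring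
  rw [ht'] at hm
  rw [hinv]
  nlinarith [hm]

theorem one_add_rpow_le_quadratic {q t : ℝ} (hq : 2 ≤ q) (ht : -1 ≤ t) (ht' : t ≤ 1) :
    (1 + t) ^ q ≤ 1 + q * t + q ^ 2 * 2 ^ q * t ^ 2 := by
  have h1 := one_add_rpow_le_tangent (p := q) (by linarith) ht
  have h2q : (1 : ℝ) ≤ 2 ^ q := Real.one_le_rpow (by norm_num) (by linarith)
  suffices h : t * ((1 + t) ^ (q - 1) - 1) ≤ q * 2 ^ q * t ^ 2 by
    have := mul_le_mul_of_nonneg_left h (by linarith : 0 ≤ q)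
    nlinarith [this]
  rcases le_total 0 t with h0 | h0
  · have h2 := one_add_rpow_le_tangent (p := q - 1) (by linarith) ht
    have h3 : (1 + t) ^ (q - 1 - 1) ≤ 2 ^ q :=
      (Real.rpow_le_rpow (by linarith) (by linarith : 1 + t ≤ 2) (by linarith)).trans
        (Real.rpow_le_rpow_of_exponent_le (by norm_num) (by linarith))
    have h4 : (q - 1) * t * (1 + t) ^ (q - 1 - 1) ≤ q * t * 2 ^ q := by
      gcongr
      linarith
    have h5 : (1 + t) ^ (q - 1) - 1 ≤ q * t * 2 ^ q := by linarith
    calc t * ((1 + t) ^ (q - 1) - 1) ≤ t * (q * t * 2 ^ q) := by gcongr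
      _ = q * 2 ^ q * t ^ 2 := by ring
  · have h2 := one_add_mul_self_le_rpow_one_add ht (by linarith : 1 ≤ q - 1)
    have h3 : t * ((1 + t) ^ (q - 1) - 1) ≤ t * ((q - 1) * t) :=
      mul_le_mul_of_nonpos_left (by linarith) h0
    have h4 : (q - 1) * 1 ≤ q * 2 ^ q := by
      gcongr
      linarith
    nlinarith [mul_le_mul_of_nonneg_right h4 (sq_nonneg t)]

theorem abs_one_add_rpow_le {q : ℝ} (hq : 2 ≤ q) (t : ℝ) :
    |1 + t| ^ q ≤ 1 + q * t + (q ^ 2 * 2 ^ q + q) * (t ^ 2 + |t| ^ q) := by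
  have h2q : (1 : ℝ) ≤ 2 ^ q := Real.one_le_rpow (by norm_num) (by linarith)
  have hq1 : 1 ≤ q ^ 2 := by nlinarith
  have htq : 0 ≤ |t| ^ q := by positivity
  rcases le_total |t| 1 with h | h
  · have ht := abs_le.1 h
    rw [abs_of_nonneg (by linarith [ht.1] : 0 ≤ 1 + t)]
    have := one_add_rpow_le_quadratic hq ht.1 ht.2
    have h1 : 0 ≤ q * (t ^ 2 + |t| ^ q) := by positivity
    have h2 : 0 ≤ q ^ 2 * 2 ^ q * |t| ^ q := by positivity
    nlinarith
  · have h1 : |1 + t| ≤ 2 * |t| := by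
      have := abs_add_le 1 t
      rw [abs_one] at this
      linarith
    have h2 : |1 + t| ^ q ≤ 2 ^ q * |t| ^ q := by
      rw [← Real.mul_rpow (by norm_num) (abs_nonneg t)]
      exact Real.rpow_le_rpow (abs_nonneg _) h1 (by linarith)
    -- The linear term may be negative; the summand `q` in the constant absorbs it.
    have h3 : -t ≤ t ^ 2 := by
      have : |t| * 1 ≤ |t| * |t| := by gcongr
      rw [abs_mul_abs_self] at this
      nlinarith [neg_abs_le t]
    have h4 : 2 ^ q * |t| ^ q ≤ q ^ 2 * 2 ^ q * |t| ^ q := by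
      have : 0 ≤ (2 : ℝ) ^ q * |t| ^ q := by positivity
      nlinarith
    have h5 : 0 ≤ q ^ 2 * 2 ^ q * t ^ 2 := by positivity
    have h6 : 0 ≤ q * |t| ^ q := by positivity
    nlinarith [mul_le_mul_of_nonneg_left h3 (by linarith : 0 ≤ q)]

theorem abs_add_rpow_le {q : ℝ} (hq : 2 ≤ q) (a b : ℝ) :
    |a + b| ^ q ≤ |a| ^ q + q * (a * |a| ^ (q - 2)) * b +
      (q ^ 2 * 2 ^ q + q) * (|a| ^ (q - 2) * b ^ 2 + |b| ^ q) := by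
  have h2q : (1 : ℝ) ≤ 2 ^ q := Real.one_le_rpow (by norm_num) (by linarith)
  rcases eq_or_ne a 0 with rfl | ha
  · have h0 : q ≠ 0 := by linarith
    have h1 : 0 ≤ |(0 : ℝ)| ^ (q - 2) * b ^ 2 := by positivity
    have h2 : 1 ≤ q ^ 2 * 2 ^ q + q := by nlinarith [sq_nonneg q]
    have h3 : 0 ≤ |b| ^ q := by positivity
    have h4 := Real.zero_rpow h0
    simp only [zero_add, zero_mul, mul_zero, abs_zero, h4] at h1 ⊢
    nlinarith
  · have ha' : 0 < |a| := abs_pos.2 ha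
    have h := mul_le_mul_of_nonneg_left (abs_one_add_rpow_le hq (b / a))
      (Real.rpow_nonneg ha'.le q)
    rw [← Real.mul_rpow ha'.le (abs_nonneg _), ← abs_mul, mul_add, mul_one,
      mul_div_cancel₀ b ha] at h
    have e1 : |a| ^ q = |a| ^ (q - 2) * a ^ 2 := by
      rw [← sq_abs a, ← Real.rpow_natCast, ← Real.rpow_add ha']
      norm_num
    have e2 : |a| ^ q * |b / a| ^ q = |b| ^ q := by
      rw [← Real.mul_rpow ha'.le (abs_nonneg _), ← abs_mul, mul_div_cancel₀ b ha]
    refine h.trans (le_of_eq ?_)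
    calc _ = |a| ^ q + q * (|a| ^ q * (b / a)) +
          (q ^ 2 * 2 ^ q + q) * (|a| ^ q * (b / a) ^ 2 + |a| ^ q * |b / a| ^ q) := by ring
      _ = _ := by
        rw [e2, e1]
        field_simp

/-- A weighted Young inequality: one of the two terms on the right suffices, according to whether `a
^ 2` exceeds `N * b ^ 2`. -/
theorem abs_rpow_mul_sq_le {q N : ℝ} (hq : 2 ≤ q) (hN : 0 < N) (a b : ℝ) :
    |a| ^ (q - 2) * b ^ 2 ≤ |a| ^ q / N + N ^ (q / 2 - 1) * |b| ^ q := by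
  have hsq : ∀ x : ℝ, |x| ^ q = |x| ^ (q - 2) * x ^ 2 := fun x => by
    rcases eq_or_ne x 0 with rfl | hx
    · simp [Real.zero_rpow (by linarith : q ≠ 0)]
    · rw [← sq_abs x, ← Real.rpow_natCast, ← Real.rpow_add (abs_pos.2 hx)]
      norm_num
  rcases le_total (a ^ 2) (N * b ^ 2) with h | h
  · have h1 : |a| ^ (q - 2) ≤ N ^ (q / 2 - 1) * |b| ^ (q - 2) := by
      have key : ∀ x : ℝ, |x| ^ (q - 2) = (x ^ 2) ^ (q / 2 - 1) := fun x => by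
        rw [← sq_abs x, ← Real.rpow_natCast, ← Real.rpow_mul (abs_nonneg x)]
        congr 1
        push_cast
        ring
      rw [key a, key b, ← Real.mul_rpow hN.le (sq_nonneg b)]
      exact Real.rpow_le_rpow (sq_nonneg a) h (by linarith)
    have h2 : 0 ≤ |a| ^ q / N := by positivity
    rw [hsq b]
    nlinarith [mul_le_mul_of_nonneg_right h1 (sq_nonneg b)]
  · have h1 : b ^ 2 ≤ a ^ 2 / N := by
      rw [le_div_iff₀ hN]
      linarith
    have h2 : 0 ≤ N ^ (q / 2 - 1) * |b| ^ q := by positivity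
    have h3 := mul_le_mul_of_nonneg_left h1 (Real.rpow_nonneg (abs_nonneg a) (q - 2))
    rw [← mul_div_assoc, ← hsq a] at h3
    linarith

theorem abs_add_rpow_le_of_one_le {q N : ℝ} (hq : 2 ≤ q) (hN : 1 ≤ N) (a b : ℝ) :
    |a + b| ^ q ≤ (1 + (q ^ 2 * 2 ^ q + q) / N) * |a| ^ q + q * (a * |a| ^ (q - 2)) * b +
      2 * (q ^ 2 * 2 ^ q + q) * N ^ (q / 2 - 1) * |b| ^ q := by
  have h1 := abs_add_rpow_le hq a b
  have h2 := abs_rpow_mul_sq_le hq (by linarith : 0 < N) a b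
  have hK : 0 ≤ q ^ 2 * 2 ^ q + q := by positivity
  have h3 : |b| ^ q ≤ N ^ (q / 2 - 1) * |b| ^ q :=
    le_mul_of_one_le_left (by positivity) (Real.one_le_rpow hN (by linarith))
  have h4 := mul_le_mul_of_nonneg_left (add_le_add h2 h3) hK
  refine h1.trans ((add_le_add_right h4 _).trans (le_of_eq ?_))
  ring

/-- Serves to make the cross term integrable. -/
theorem abs_mul_abs_rpow_mul_le {q : ℝ} (hq : 2 ≤ q) (a b : ℝ) :
    |a * |a| ^ (q - 2) * b| ≤ |a| ^ q + |b| ^ q := by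
  have hpow : ∀ x : ℝ, |x| * |x| ^ (q - 2) = |x| ^ (q - 1) := fun x => by
    rcases eq_or_ne x 0 with rfl | hx
    · simp [Real.zero_rpow (by linarith : q - 1 ≠ 0)]
    · rw [← Real.rpow_one_add' (abs_nonneg x) (by linarith)]
      congr 1
      ring
  have hpow' : ∀ x : ℝ, |x| ^ (q - 1) * |x| = |x| ^ q := fun x => by
    rw [← Real.rpow_add_one' (abs_nonneg x) (by linarith), sub_add_cancel]
  rw [abs_mul, abs_mul, abs_of_nonneg (Real.rpow_nonneg (abs_nonneg a) _), hpow]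
  rcases le_total |a| |b| with h | h
  · have : |a| ^ (q - 1) * |b| ≤ |b| ^ (q - 1) * |b| := by
      gcongr
      linarith
    rw [hpow'] at this
    exact this.trans (le_add_of_nonneg_left (by positivity))
  · have : |a| ^ (q - 1) * |b| ≤ |a| ^ (q - 1) * |a| := by gcongr
    rw [hpow'] at this
    exact this.trans (le_add_of_nonneg_right (by positivity))

/-! ### Moments and integrability on a probability space -/

theorem lintegral_rpow_le_of_isProbabilityMeasure {α : Type*} [MeasurableSpace α]
    (μ : Measure α) [IsProbabilityMeasure μ] {q : ℝ} (hq : 1 ≤ q) {g : α → ℝ≥0∞}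
    (hg : Measurable g) : (∫⁻ x, g x ∂μ) ^ q ≤ ∫⁻ x, g x ^ q ∂μ := by
  have h := eLpNorm'_le_eLpNorm'_of_exponent_le one_pos hq μ hg.aestronglyMeasurable
  simp only [eLpNorm', enorm_eq_self, ENNReal.rpow_one, div_one] at h
  rw [one_div, ENNReal.le_rpow_inv_iff (by linarith)] at h
  exact h

theorem lintegral_add_rpow_le {α : Type*} [MeasurableSpace α] (μ : Measure α)
    {q : ℝ} (hq : 1 ≤ q) {u v : α → ℝ≥0∞} (hu : Measurable u) :
    ∫⁻ x, (u x + v x) ^ q ∂μ ≤ 2 ^ (q - 1) * (∫⁻ x, u x ^ q ∂μ + ∫⁻ x, v x ^ q ∂μ) := by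
  calc ∫⁻ x, (u x + v x) ^ q ∂μ ≤ ∫⁻ x, 2 ^ (q - 1) * (u x ^ q + v x ^ q) ∂μ :=
        lintegral_mono fun x => ENNReal.rpow_add_le_mul_rpow_add_rpow _ _ hq
    _ = _ := by
      rw [lintegral_const_mul' _ _
        (ENNReal.rpow_ne_top_of_nonneg (by linarith) ENNReal.ofNat_ne_top),
        lintegral_add_left (hu.pow_const q)]

theorem integrable_and_enorm_sub_integral_le {α : Type*} [MeasurableSpace α] (μ : Measure α)
    [IsProbabilityMeasure μ] {f : α → ℝ} {g : α → ℝ≥0∞} (hf : Measurable f)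
    (hg : Measurable g) (hfg : ∀ x x', ‖f x - f x'‖ₑ ≤ g x + g x')
    (hfin : ∫⁻ x, g x ∂μ ≠ ∞) :
    Integrable f μ ∧ ∀ x, ‖f x - ∫ x', f x' ∂μ‖ₑ ≤ g x + ∫⁻ x', g x' ∂μ := by
  have hint : Integrable f μ := by
    obtain ⟨x₀, hx₀⟩ := (ae_lt_top hg hfin).exists
    have h : Integrable (fun x => f x - f x₀) μ := by
      refine ⟨(hf.sub_const _).aestronglyMeasurable, ?_⟩
      refine (lintegral_mono fun x => hfg x x₀).trans_lt ?_
      rw [lintegral_add_left hg]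
      simp [hfin.lt_top, hx₀]
    exact (h.add (integrable_const (f x₀))).congr (Filter.Eventually.of_forall fun x => by simp)
  refine ⟨hint, fun x => ?_⟩
  have h : f x - ∫ x', f x' ∂μ = ∫ x', (f x - f x') ∂μ := by
    rw [integral_sub (integrable_const _) hint]
    simp
  rw [h]
  refine (enorm_integral_le_lintegral_enorm _).trans ((lintegral_mono fun x' => hfg x x').trans ?_)
  rw [lintegral_add_left measurable_const]
  simp

theorem ofReal_abs_rpow_eq_enorm_rpow {q : ℝ} (hq : 0 ≤ q) (x : ℝ) :
    ENNReal.ofReal (|x| ^ q) = ‖x‖ₑ ^ q := by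
  rw [Real.enorm_eq_ofReal_abs, ENNReal.ofReal_rpow_of_nonneg (abs_nonneg x) hq]

theorem integrable_abs_rpow_iff {α : Type*} [MeasurableSpace α] {μ : Measure α} {q : ℝ}
    (hq : 0 ≤ q) {f : α → ℝ} (hf : Measurable f) :
    Integrable (fun x => |f x| ^ q) μ ↔ ∫⁻ x, ‖f x‖ₑ ^ q ∂μ < ∞ := by
  have hm : Measurable fun x => |f x| ^ q := (hf.abs).pow_const q
  rw [← lintegral_congr fun x => ofReal_abs_rpow_eq_enorm_rpow hq (f x)]
  exact ⟨fun h => by simpa using h.lintegral_lt_top, fun h =>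
    (lintegral_ofReal_ne_top_iff_integrable hm.aestronglyMeasurable
      (Filter.Eventually.of_forall fun x => by positivity)).1 h.ne⟩

theorem integrable_of_lintegral_enorm_rpow_lt_top {α : Type*} [MeasurableSpace α]
    {μ : Measure α} [IsProbabilityMeasure μ] {q : ℝ} (hq : 1 ≤ q) {f : α → ℝ}
    (hf : Measurable f) (h : ∫⁻ x, ‖f x‖ₑ ^ q ∂μ < ∞) : Integrable f μ := by
  refine ⟨hf.aestronglyMeasurable, ?_⟩
  have := (lintegral_rpow_le_of_isProbabilityMeasure μ hq hf.enorm).trans_lt h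
  rwa [ENNReal.rpow_lt_top_iff_of_pos (by linarith)] at this

/-! ### Averaging over the first factor of a product -/

theorem integrable_fst_section_of_enorm_sub_le {α β : Type*} [MeasurableSpace α]
    [MeasurableSpace β] (μ : Measure α) [IsProbabilityMeasure μ]
    {f : α × β → ℝ} {g : α × β → ℝ≥0∞} (hf : Measurable f) (hg : Measurable g)
    (hfg : ∀ x x' y, ‖f (x, y) - f (x', y)‖ₑ ≤ g (x, y) + g (x', y)) {y : β}
    (hy : ∫⁻ x, g (x, y) ∂μ ≠ ∞) :
    Integrable (fun x => f (x, y)) μ ∧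
      ∀ x, ‖f (x, y) - ∫ x', f (x', y) ∂μ‖ₑ ≤ g (x, y) + ∫⁻ x', g (x', y) ∂μ :=
  integrable_and_enorm_sub_integral_le μ (hf.comp measurable_prodMk_right)
    (hg.comp measurable_prodMk_right) (fun x x' => hfg x x' y) hy

theorem ae_lintegral_fst_ne_top {α β : Type*} [MeasurableSpace α] [MeasurableSpace β]
    (μ : Measure α) [IsProbabilityMeasure μ] (ν : Measure β) [IsProbabilityMeasure ν]
    {q : ℝ} (hq : 1 ≤ q) {g : α × β → ℝ≥0∞} (hg : Measurable g)
    (hfin : ∫⁻ z, g z ^ q ∂μ.prod ν ≠ ∞) : ∀ᵐ y ∂ν, ∫⁻ x, g (x, y) ∂μ ≠ ∞ := by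
  rw [lintegral_prod_symm' _ (hg.pow_const q)] at hfin
  filter_upwards [ae_lt_top (hg.pow_const q).lintegral_prod_left' hfin] with y hy
  have h := (lintegral_rpow_le_of_isProbabilityMeasure μ hq
    (hg.comp (measurable_prodMk_right (y := y)))).trans_lt hy
  exact ((ENNReal.rpow_lt_top_iff_of_pos (by linarith)).1 h).ne

theorem lintegral_lintegral_fst_rpow_le {α β : Type*} [MeasurableSpace α] [MeasurableSpace β]
    (μ : Measure α) [IsProbabilityMeasure μ] (ν : Measure β) [IsProbabilityMeasure ν]
    {q : ℝ} (hq : 1 ≤ q) {g : α × β → ℝ≥0∞} (hg : Measurable g) :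
    ∫⁻ y, (∫⁻ x, g (x, y) ∂μ) ^ q ∂ν ≤ ∫⁻ z, g z ^ q ∂μ.prod ν := by
  rw [lintegral_prod_symm' _ (hg.pow_const q)]
  exact lintegral_mono fun y => lintegral_rpow_le_of_isProbabilityMeasure μ hq
    (hg.comp measurable_prodMk_right)

theorem lintegral_enorm_sub_fst_integral_rpow_le {α β : Type*} [MeasurableSpace α]
    [MeasurableSpace β] (μ : Measure α) [IsProbabilityMeasure μ] (ν : Measure β)
    [IsProbabilityMeasure ν] {q : ℝ} (hq : 1 ≤ q)
    {f : α × β → ℝ} {g : α × β → ℝ≥0∞} (hf : Measurable f) (hg : Measurable g)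
    (hfg : ∀ x x' y, ‖f (x, y) - f (x', y)‖ₑ ≤ g (x, y) + g (x', y))
    (hfin : ∫⁻ z, g z ^ q ∂μ.prod ν ≠ ∞) :
    ∫⁻ z, ‖f z - ∫ x, f (x, z.2) ∂μ‖ₑ ^ q ∂μ.prod ν ≤ 2 ^ q * ∫⁻ z, g z ^ q ∂μ.prod ν := by
  have hgood := ae_lintegral_fst_ne_top μ ν hq hg hfin
  have hgood' : ∀ᵐ z ∂μ.prod ν, ∫⁻ x, g (x, z.2) ∂μ ≠ ∞ :=
    Measure.quasiMeasurePreserving_snd.ae hgood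
  have hG : Measurable fun y => ∫⁻ x, g (x, y) ∂μ := hg.lintegral_prod_left'
  calc ∫⁻ z, ‖f z - ∫ x, f (x, z.2) ∂μ‖ₑ ^ q ∂μ.prod ν
      ≤ ∫⁻ z, (g z + ∫⁻ x, g (x, z.2) ∂μ) ^ q ∂μ.prod ν := by
        refine lintegral_mono_ae ?_
        filter_upwards [hgood'] with z hz
        exact ENNReal.rpow_le_rpow
          ((integrable_fst_section_of_enorm_sub_le μ hf hg hfg hz).2 z.1) (by linarith)
    _ ≤ 2 ^ (q - 1) * (∫⁻ z, g z ^ q ∂μ.prod ν +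
          ∫⁻ z, (∫⁻ x, g (x, z.2) ∂μ) ^ q ∂μ.prod ν) := lintegral_add_rpow_le _ hq hg
    _ ≤ 2 ^ (q - 1) * (∫⁻ z, g z ^ q ∂μ.prod ν + ∫⁻ z, g z ^ q ∂μ.prod ν) := by
        refine mul_le_mul_right (add_le_add_right ?_ _) _
        have hGs : Measurable fun z : α × β => (∫⁻ x, g (x, z.2) ∂μ) ^ q :=
          (hG.comp measurable_snd).pow_const q
        rw [lintegral_prod_symm' _ hGs]
        simpa using lintegral_lintegral_fst_rpow_le μ ν hq hg
    _ = 2 ^ q * ∫⁻ z, g z ^ q ∂μ.prod ν := by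
        rw [← two_mul, ← mul_assoc]
        congr 1
        nth_rw 2 [← ENNReal.rpow_one 2]
        rw [← ENNReal.rpow_add _ _ two_ne_zero ENNReal.ofNat_ne_top, sub_add_cancel]

theorem integral_mul_sub_fst_integral_eq_zero {α β : Type*} [MeasurableSpace α]
    [MeasurableSpace β] (μ : Measure α) [IsProbabilityMeasure μ] (ν : Measure β)
    [IsProbabilityMeasure ν] {f : α × β → ℝ} (φ : β → ℝ)
    (hf : ∀ᵐ y ∂ν, Integrable (fun x => f (x, y)) μ)
    (hint : Integrable (fun z : α × β => φ z.2 * (f z - ∫ x, f (x, z.2) ∂μ)) (μ.prod ν)) :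
    ∫ z, φ z.2 * (f z - ∫ x, f (x, z.2) ∂μ) ∂μ.prod ν = 0 := by
  rw [integral_prod_symm _ hint]
  refine integral_eq_zero_of_ae ?_
  filter_upwards [hf] with y hy
  simp only [integral_const_mul, Pi.zero_apply]
  rw [integral_sub hy (integrable_const _)]
  simp

/-- One step of the martingale decomposition along the first coordinate of a product. -/
theorem lintegral_enorm_sub_integral_rpow_prod_le {α β : Type*} [MeasurableSpace α]
    [MeasurableSpace β] (μ : Measure α) [IsProbabilityMeasure μ] (ν : Measure β)
    [IsProbabilityMeasure ν] {q : ℝ} (hq : 2 ≤ q) {A B : ℝ} (hA : 0 ≤ A) (hB : 0 ≤ B)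
    (hAB : ∀ a b : ℝ,
      |a + b| ^ q ≤ A * |a| ^ q + q * (a * |a| ^ (q - 2)) * b + B * |b| ^ q)
    {f : α × β → ℝ} {g : α × β → ℝ≥0∞} (hf : Measurable f) (hg : Measurable g)
    (hfg : ∀ x x' y, ‖f (x, y) - f (x', y)‖ₑ ≤ g (x, y) + g (x', y))
    (hfin : ∫⁻ z, g z ^ q ∂μ.prod ν ≠ ∞)
    (hh : Integrable (fun y => ∫ x, f (x, y) ∂μ) ν)
    (hhfin : ∫⁻ y, ‖(∫ x, f (x, y) ∂μ) - ∫ y', ∫ x, f (x, y') ∂μ ∂ν‖ₑ ^ q ∂ν ≠ ∞) :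
    Integrable f (μ.prod ν) ∧
      ∫⁻ z, ‖f z - ∫ z', f z' ∂μ.prod ν‖ₑ ^ q ∂μ.prod ν ≤
        ENNReal.ofReal A *
          ∫⁻ y, ‖(∫ x, f (x, y) ∂μ) - ∫ y', ∫ x, f (x, y') ∂μ ∂ν‖ₑ ^ q ∂ν +
        ENNReal.ofReal B * (2 ^ q * ∫⁻ z, g z ^ q ∂μ.prod ν) := by
  have hq0 : 0 ≤ q := by linarith
  have hq1 : 1 ≤ q := by linarith
  set h : β → ℝ := fun y => ∫ x, f (x, y) ∂μ with hdef
  set m : ℝ := ∫ y', h y' ∂ν with hm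
  have hhm : Measurable h := hf.stronglyMeasurable.integral_prod_left'.measurable
  let φ : β → ℝ := fun y => (h y - m) * |h y - m| ^ (q - 2)
  have hφ : Measurable φ := (hhm.sub_const m).mul ((hhm.sub_const m).abs.pow_const (q - 2))
  have hbm : Measurable fun z : α × β => f z - h z.2 := hf.sub (hhm.comp measurable_snd)
  have ham : Measurable fun z : α × β => h z.2 - m := (hhm.comp measurable_snd).sub_const m
  have hble : ∫⁻ z, ‖f z - h z.2‖ₑ ^ q ∂μ.prod ν ≤ 2 ^ q * ∫⁻ z, g z ^ q ∂μ.prod ν :=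
    lintegral_enorm_sub_fst_integral_rpow_le μ ν hq1 hf hg hfg hfin
  have hbfin : ∫⁻ z, ‖f z - h z.2‖ₑ ^ q ∂μ.prod ν < ∞ :=
    hble.trans_lt (ENNReal.mul_lt_top
      (ENNReal.rpow_lt_top_of_nonneg hq0 ENNReal.ofNat_ne_top) hfin.lt_top)
  have haeq : ∫⁻ z : α × β, ‖h z.2 - m‖ₑ ^ q ∂μ.prod ν = ∫⁻ y, ‖h y - m‖ₑ ^ q ∂ν := by
    rw [lintegral_prod_symm' _ (ham.enorm.pow_const q)]
    simp
  have hsec : ∀ᵐ y ∂ν, Integrable (fun x => f (x, y)) μ := by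
    filter_upwards [ae_lintegral_fst_ne_top μ ν hq1 hg hfin] with y hy
    exact (integrable_fst_section_of_enorm_sub_le μ hf hg hfg hy).1
  have hbint : Integrable (fun z : α × β => f z - h z.2) (μ.prod ν) :=
    integrable_of_lintegral_enorm_rpow_lt_top hq1 hbm hbfin
  have hfint : Integrable f (μ.prod ν) :=
    (hbint.add (hh.comp_snd μ)).congr (Filter.Eventually.of_forall fun z => by simp)
  have hmean : ∫ z, f z ∂μ.prod ν = m := integral_prod_symm f hfint
  have hbq : Integrable (fun z : α × β => |f z - h z.2| ^ q) (μ.prod ν) :=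
    (integrable_abs_rpow_iff hq0 hbm).2 hbfin
  have haq : Integrable (fun z : α × β => |h z.2 - m| ^ q) (μ.prod ν) :=
    (integrable_abs_rpow_iff hq0 ham).2 (haeq ▸ hhfin.lt_top)
  have hcross : Integrable (fun z : α × β => φ z.2 * (f z - h z.2)) (μ.prod ν) :=
    (haq.add hbq).mono' ((hφ.comp measurable_snd).mul hbm).aestronglyMeasurable
      (Filter.Eventually.of_forall fun z => abs_mul_abs_rpow_mul_le hq _ _)
  have hzero : ∫ z, φ z.2 * (f z - h z.2) ∂μ.prod ν = 0 :=
    integral_mul_sub_fst_integral_eq_zero μ ν φ hsec hcross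
  have hpt : ∀ z : α × β, |f z - m| ^ q ≤
      A * |h z.2 - m| ^ q + q * (φ z.2 * (f z - h z.2)) + B * |f z - h z.2| ^ q := fun z => by
    have := hAB (h z.2 - m) (f z - h z.2)
    rwa [show h z.2 - m + (f z - h z.2) = f z - m by ring, mul_assoc q] at this
  have hR : Integrable (fun z : α × β =>
      A * |h z.2 - m| ^ q + q * (φ z.2 * (f z - h z.2)) + B * |f z - h z.2| ^ q) (μ.prod ν) :=
    ((haq.const_mul A).add (hcross.const_mul q)).add (hbq.const_mul B)
  have hnn : ∀ z : α × β, 0 ≤ |f z - m| ^ q := fun z => by positivity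
  have hconv : ∀ u : α × β → ℝ, Integrable (fun z => |u z| ^ q) (μ.prod ν) →
      ENNReal.ofReal (∫ z, |u z| ^ q ∂μ.prod ν) = ∫⁻ z, ‖u z‖ₑ ^ q ∂μ.prod ν := fun u hu => by
    rw [ofReal_integral_eq_lintegral_ofReal hu
      (Filter.Eventually.of_forall fun z => by positivity)]
    exact lintegral_congr fun z => ofReal_abs_rpow_eq_enorm_rpow hq0 _
  refine ⟨hfint, ?_⟩
  rw [hmean]
  calc ∫⁻ z, ‖f z - m‖ₑ ^ q ∂μ.prod ν
      = ∫⁻ z, ENNReal.ofReal (|f z - m| ^ q) ∂μ.prod ν :=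
        lintegral_congr fun z => (ofReal_abs_rpow_eq_enorm_rpow hq0 _).symm
    _ ≤ ∫⁻ z, ENNReal.ofReal (A * |h z.2 - m| ^ q + q * (φ z.2 * (f z - h z.2)) +
          B * |f z - h z.2| ^ q) ∂μ.prod ν :=
        lintegral_mono fun z => ENNReal.ofReal_le_ofReal (hpt z)
    -- The cross term has no sign, but the whole majorant dominates `|f z - m| ^ q` and so is
    -- nonnegative.
    _ = ENNReal.ofReal (∫ z, (A * |h z.2 - m| ^ q + q * (φ z.2 * (f z - h z.2)) +
          B * |f z - h z.2| ^ q) ∂μ.prod ν) :=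
        (ofReal_integral_eq_lintegral_ofReal hR
          (Filter.Eventually.of_forall fun z => (hnn z).trans (hpt z))).symm
    _ = ENNReal.ofReal (A * ∫ z, |h z.2 - m| ^ q ∂μ.prod ν +
          B * ∫ z, |f z - h z.2| ^ q ∂μ.prod ν) := by
        have hAC : Integrable (fun z : α × β =>
            A * |h z.2 - m| ^ q + q * (φ z.2 * (f z - h z.2))) (μ.prod ν) :=
          (haq.const_mul A).add (hcross.const_mul q)
        rw [integral_add hAC (hbq.const_mul B), integral_add (haq.const_mul A) (hcross.const_mul q), integral_const_mul,
          integral_const_mul, integral_const_mul, hzero, mul_zero, add_zero]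
    _ = ENNReal.ofReal A * ∫⁻ y, ‖h y - m‖ₑ ^ q ∂ν +
          ENNReal.ofReal B * ∫⁻ z, ‖f z - h z.2‖ₑ ^ q ∂μ.prod ν := by
        rw [ENNReal.ofReal_add (by positivity) (by positivity), ENNReal.ofReal_mul hA,
          ENNReal.ofReal_mul hB, hconv _ haq, hconv _ hbq, haeq]
    _ ≤ _ := by gcongr

/-- A bound for the averaged differences: infinite at the points where the average over the
first coordinate is not known to exist. -/
theorem exists_averaged_difference_bound {α β : Type*} [MeasurableSpace α]
    [MeasurableSpace β] (μ : Measure α) [IsProbabilityMeasure μ] (ν : Measure β)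
    [IsProbabilityMeasure ν] {q : ℝ} (hq : 1 ≤ q) {f : α × β → ℝ} {g : α × β → ℝ≥0∞}
    (hf : Measurable f) (hg : Measurable g)
    (hfg : ∀ x x' y, ‖f (x, y) - f (x', y)‖ₑ ≤ g (x, y) + g (x', y))
    (hfin : ∫⁻ z, g z ^ q ∂μ.prod ν ≠ ∞) {k : α × β → ℝ≥0∞} (hk : Measurable k) :
    ∃ G : β → ℝ≥0∞, Measurable G ∧
      (∀ y y', (∀ x, ‖f (x, y) - f (x, y')‖ₑ ≤ k (x, y) + k (x, y')) →
        ‖∫ x, f (x, y) ∂μ - ∫ x, f (x, y') ∂μ‖ₑ ≤ G y + G y') ∧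
      ∫⁻ y, G y ^ q ∂ν ≤ ∫⁻ z, k z ^ q ∂μ.prod ν := by
  classical
  have hgm : Measurable fun y => ∫⁻ x, g (x, y) ∂μ := hg.lintegral_prod_left'
  have hkm : Measurable fun y => ∫⁻ x, k (x, y) ∂μ := hk.lintegral_prod_left'
  -- The induction needs the difference bound at every point. The value `∞` makes it trivial where
  -- it could fail, and occurs only on a null set, so moments are unaffected.
  refine ⟨fun y => if ∫⁻ x, g (x, y) ∂μ = ∞ then ∞ else ∫⁻ x, k (x, y) ∂μ, ?_, ?_, ?_⟩
  · exact Measurable.ite (hgm (measurableSet_singleton ∞)) measurable_const hkm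
  · intro y y' hyy'
    dsimp only
    split_ifs with h1 h2 h2
    · simp
    · simp
    · simp
    · rw [← integral_sub (integrable_fst_section_of_enorm_sub_le μ hf hg hfg h1).1
        (integrable_fst_section_of_enorm_sub_le μ hf hg hfg h2).1]
      refine (enorm_integral_le_lintegral_enorm _).trans ((lintegral_mono hyy').trans ?_)
      have hky : Measurable fun x => k (x, y) := hk.comp measurable_prodMk_right
      rw [lintegral_add_left hky]
  · refine le_trans (lintegral_mono_ae ?_) (lintegral_lintegral_fst_rpow_le μ ν hq hk)
    filter_upwards [ae_lintegral_fst_ne_top μ ν hq hg hfin] with y hy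
    rw [if_neg hy]

/-! ### Induction on the number of coordinates -/

/-- `A` and `B` stay fixed during the induction, so they may later be chosen in terms of the final
`n`. -/
theorem integrable_and_lintegral_enorm_sub_integral_rpow_pi_le {q : ℝ} (hq : 2 ≤ q) {A B : ℝ}
    (hA : 1 ≤ A) (hB : 0 ≤ B)
    (hAB : ∀ a b : ℝ,
      |a + b| ^ q ≤ A * |a| ^ q + q * (a * |a| ^ (q - 2)) * b + B * |b| ^ q) (n : ℕ) :
    ∀ (E : Fin n → Type*) [∀ i, MeasurableSpace (E i)] (μ : ∀ i, Measure (E i))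
      [∀ i, IsProbabilityMeasure (μ i)]
      (f : (∀ i, E i) → ℝ) (g : Fin n → (∀ i, E i) → ℝ≥0∞),
      Measurable f → (∀ i, Measurable (g i)) →
      (∀ (i : Fin n) (x x' : ∀ i, E i), (∀ j, j ≠ i → x j = x' j) →
        ‖f x - f x'‖ₑ ≤ g i x + g i x') →
      ∑ i, ∫⁻ x, g i x ^ q ∂Measure.pi μ ≠ ∞ →
      Integrable f (Measure.pi μ) ∧
        ∫⁻ x, ‖f x - ∫ x', f x' ∂Measure.pi μ‖ₑ ^ q ∂Measure.pi μ ≤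
          ENNReal.ofReal (A ^ n * (B * 2 ^ q)) * ∑ i, ∫⁻ x, g i x ^ q ∂Measure.pi μ := by
  induction n with
  | zero =>
    intro E _ μ _ f g _ _ _ _
    have hc : ∀ x, f x = f default := fun x => congrArg f (Subsingleton.elim _ _)
    have hint : Integrable f (Measure.pi μ) :=
      (integrable_const (f default)).congr (Filter.Eventually.of_forall fun x => (hc x).symm)
    refine ⟨hint, ?_⟩
    simp [hc, (by linarith : 0 < q)]
  | succ n ih =>
    intro E _ μ _ f g hf hg hfg hfin
    have hA0 : 0 ≤ A := by linarith
    have hq1 : 1 ≤ q := by linarith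
    let e := MeasurableEquiv.piFinSuccAbove E 0
    let ν := Measure.pi fun j => μ ((0 : Fin (n + 1)).succAbove j)
    have he0 : ∀ x y, e.symm (x, y) 0 = x := fun x y =>
      Fin.insertNth_apply_same (α := E) 0 x y
    have hek : ∀ x y k, e.symm (x, y) ((0 : Fin (n + 1)).succAbove k) = y k := fun x y k =>
      Fin.insertNth_apply_succAbove (α := E) 0 x y k
    have he : MeasurePreserving e (Measure.pi μ) ((μ 0).prod ν) :=
      measurePreserving_piFinSuccAbove μ 0
    have hes : MeasurePreserving e.symm ((μ 0).prod ν) (Measure.pi μ) := he.symm e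
    have hl : ∀ u : (∀ i, E i) → ℝ≥0∞,
        ∫⁻ z, u (e.symm z) ∂(μ 0).prod ν = ∫⁻ x, u x ∂Measure.pi μ := fun u =>
      hes.lintegral_comp_emb e.symm.measurableEmbedding u
    have hi : ∫ z, f (e.symm z) ∂(μ 0).prod ν = ∫ x, f x ∂Measure.pi μ :=
      hes.integral_comp e.symm.measurableEmbedding f
    have hfm : Measurable fun z => f (e.symm z) := hf.comp e.symm.measurable
    have hgm : ∀ i, Measurable fun z => g i (e.symm z) := fun i =>
      (hg i).comp e.symm.measurable
    have hne : ∀ i, ∫⁻ x, g i x ^ q ∂Measure.pi μ ≠ ∞ := fun i =>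
      (ENNReal.sum_ne_top.1 hfin) i (Finset.mem_univ i)
    have hfin0 : ∫⁻ z, g 0 (e.symm z) ^ q ∂(μ 0).prod ν ≠ ∞ := by
      rw [hl fun x => g 0 x ^ q]
      exact hne 0
    have hfg0 : ∀ x x' y, ‖f (e.symm (x, y)) - f (e.symm (x', y))‖ₑ ≤
        g 0 (e.symm (x, y)) + g 0 (e.symm (x', y)) := fun x x' y => by
      refine hfg 0 _ _ fun j hj => ?_
      obtain ⟨k, rfl⟩ := Fin.exists_succAbove_eq hj
      rw [hek, hek]
    choose G hGm hG hGle using fun i : Fin n => exists_averaged_difference_bound (μ 0) ν hq1 hfm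
      (hgm 0) hfg0 hfin0 (hgm ((0 : Fin (n + 1)).succAbove i))
    have hGle' : ∀ i, ∫⁻ y, G i y ^ q ∂ν ≤
        ∫⁻ x, g ((0 : Fin (n + 1)).succAbove i) x ^ q ∂Measure.pi μ := fun i =>
      (hGle i).trans_eq (hl fun x => g ((0 : Fin (n + 1)).succAbove i) x ^ q)
    have hsum := Finset.sum_le_sum fun i (_ : i ∈ Finset.univ) => hGle' i
    have hsumfin : ∑ i : Fin n,
        ∫⁻ x, g ((0 : Fin (n + 1)).succAbove i) x ^ q ∂Measure.pi μ ≠ ∞ :=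
      ENNReal.sum_ne_top.2 fun i _ => hne _
    obtain ⟨hhint, hhle⟩ := ih (fun j => E ((0 : Fin (n + 1)).succAbove j))
      (fun j => μ ((0 : Fin (n + 1)).succAbove j))
      (fun y => ∫ x, f (e.symm (x, y)) ∂μ 0) G
      hfm.stronglyMeasurable.integral_prod_left'.measurable hGm
      (fun i y y' hyy' => hG i y y' fun x => by
        refine hfg _ _ _ fun j hj => ?_
        rcases eq_or_ne j 0 with rfl | hj0
        · rw [he0, he0]
        · obtain ⟨k, rfl⟩ := Fin.exists_succAbove_eq hj0
          have hk : k ≠ i := fun h => hj (h ▸ rfl)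
          rw [hek, hek]
          exact hyy' k hk)
      (hsum.trans_lt hsumfin.lt_top).ne
    have hhle' := hhle.trans (mul_le_mul_right hsum _)
    obtain ⟨hfint, hle⟩ := lintegral_enorm_sub_integral_rpow_prod_le (μ 0) ν hq hA0 hB hAB hfm
      (hgm 0) hfg0 hfin0 hhint
      (hhle'.trans_lt (ENNReal.mul_lt_top ENNReal.ofReal_lt_top hsumfin.lt_top)).ne
    refine ⟨(hes.integrable_comp_emb e.symm.measurableEmbedding).1 hfint, ?_⟩
    rw [hi, hl fun x => ‖f x - ∫ x', f x' ∂Measure.pi μ‖ₑ ^ q, hl fun x => g 0 x ^ q] at hle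
    refine hle.trans ?_
    -- Coordinate `0` contributes `B * 2 ^ q`, enlarged using `1 ≤ A`; the others gain one factor
    -- `A`.
    rw [Fin.sum_univ_succAbove _ 0, mul_add, add_comm]
    refine add_le_add ?_ ?_
    · rw [← mul_assoc]
      refine mul_le_mul_left ?_ _
      have h2 : (2 : ℝ≥0∞) ^ q = ENNReal.ofReal (2 ^ q) := by
        rw [← ENNReal.ofReal_rpow_of_pos two_pos]
        simp
      rw [h2, ← ENNReal.ofReal_mul hB]
      exact ENNReal.ofReal_le_ofReal
        (le_mul_of_one_le_left (by positivity) (one_le_pow₀ hA))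
    · refine (mul_le_mul_right hhle' _).trans (le_of_eq ?_)
      rw [← mul_assoc, ← ENNReal.ofReal_mul hA0, ← mul_assoc, pow_succ']

theorem mainTheorem7 (q : ℝ) (hq : 2 ≤ q) :
    ∃ C : ℝ, 0 < C ∧
      ∀ (n : ℕ) (E : Fin n → Type*) [∀ i, MeasurableSpace (E i)]
        (f : (∀ i, E i) → ℝ) (g : Fin n → (∀ i, E i) → ℝ≥0∞),
        Measurable f → (∀ i, Measurable (g i)) →
        (∀ (i : Fin n) (x x' : ∀ i, E i), (∀ j, j ≠ i → x j = x' j) →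
          ENNReal.ofReal |f x - f x'| ≤ g i x + g i x') →
        ∀ (Ω : Type*) [MeasurableSpace Ω] (P : Measure Ω) [IsProbabilityMeasure P]
          (X : ∀ i, Ω → E i), (∀ i, Measurable (X i)) → iIndepFun X P →
          ((∑ i, ∫⁻ ω, g i (fun j => X j ω) ^ q ∂P) < ∞ →
            Integrable (fun ω => f (fun j => X j ω)) P) ∧
          ∫⁻ ω, ENNReal.ofReal
              (|f (fun j => X j ω) - ∫ ω', f (fun j => X j ω') ∂P| ^ q) ∂P
            ≤ ENNReal.ofReal (C * (n : ℝ) ^ (q / 2 - 1)) *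
              ∑ i, ∫⁻ ω, g i (fun j => X j ω) ^ q ∂P := by
  have hq0 : 0 ≤ q := by linarith
  set K : ℝ := q ^ 2 * 2 ^ q + q with hK
  have hKpos : 0 < K := by positivity
  -- `exp K` bounds `(1 + K / n) ^ n`, `2 * K` is from the scalar inequality, `2 ^ q` from centring
  -- in one coordinate.
  refine ⟨Real.exp K * (2 * K * 2 ^ q), by positivity, ?_⟩
  intro n E _ f g hf hg hfg Ω _ P _ X hX hind
  have hXm : Measurable fun ω j => X j ω := measurable_pi_lambda _ hX
  have hmap := (iIndepFun_iff_map_fun_eq_pi_map fun i => (hX i).aemeasurable).1 hind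
  have : ∀ i, IsProbabilityMeasure (P.map (X i)) := fun i =>
    Measure.isProbabilityMeasure_map (hX i).aemeasurable
  have hfg' : ∀ (i : Fin n) (x x' : ∀ i, E i), (∀ j, j ≠ i → x j = x' j) →
      ‖f x - f x'‖ₑ ≤ g i x + g i x' := fun i x x' h => by
    rw [Real.enorm_eq_ofReal_abs]
    exact hfg i x x' h
  have hgl : ∀ i, ∫⁻ ω, g i (fun j => X j ω) ^ q ∂P =
      ∫⁻ x, g i x ^ q ∂Measure.pi fun i => P.map (X i) := fun i => by
    rw [← hmap, lintegral_map ((hg i).pow_const q) hXm]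
  have hfi : ∫ ω, f (fun j => X j ω) ∂P = ∫ x, f x ∂Measure.pi fun i => P.map (X i) := by
    rw [← hmap, integral_map hXm.aemeasurable hf.aestronglyMeasurable]
  have hfl : ∫⁻ ω, ENNReal.ofReal
        (|f (fun j => X j ω) - ∫ ω', f (fun j => X j ω') ∂P| ^ q) ∂P =
      ∫⁻ x, ‖f x - ∫ x', f x' ∂Measure.pi fun i => P.map (X i)‖ₑ ^ q
        ∂Measure.pi fun i => P.map (X i) := by
    rw [hfi]
    simp only [ofReal_abs_rpow_eq_enorm_rpow hq0]
    conv_rhs => rw [← hmap, lintegral_map ((hf.sub_const _).enorm.pow_const q) hXm, hmap]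
  simp only [hgl, hfl]
  -- The choice `N = n` requires `1 ≤ n`; for `n = 0` the value `N = 1` serves.
  rcases n.eq_zero_or_pos with rfl | hn
  · obtain ⟨h1, h2⟩ := integrable_and_lintegral_enorm_sub_integral_rpow_pi_le hq
      (hA := le_add_of_nonneg_right (by positivity)) (by positivity) (abs_add_rpow_le_of_one_le hq le_rfl)
      0 E (fun i => P.map (X i)) f g hf hg hfg' (by simp)
    refine ⟨fun _ => ?_, by simpa using h2⟩
    rw [← hmap] at h1
    exact h1.comp_measurable hXm
  have hn1 : (1 : ℝ) ≤ n := by exact_mod_cast hn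
  have hn0 : (0 : ℝ) < n := by linarith
  have main := integrable_and_lintegral_enorm_sub_integral_rpow_pi_le hq
    (hA := le_add_of_nonneg_right (by positivity)) (by positivity)
    (abs_add_rpow_le_of_one_le hq hn1) n E (fun i => P.map (X i)) f g hf hg hfg'
  refine ⟨fun h => ?_, ?_⟩
  · have h1 := (main h.ne).1
    rw [← hmap] at h1
    exact h1.comp_measurable hXm
  · rcases eq_or_ne (∑ i, ∫⁻ x, g i x ^ q ∂Measure.pi fun i => P.map (X i)) ∞ with h | h
    · rw [h, ENNReal.mul_top]
      · exact le_top
      · rw [Ne, ENNReal.ofReal_eq_zero, not_le]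
        positivity
    · refine (main h).2.trans (mul_le_mul_left (ENNReal.ofReal_le_ofReal ?_) _)
      rw [← hK]
      have hexp : (1 + K / n) ^ n ≤ Real.exp K := by
        calc (1 + K / n) ^ n ≤ Real.exp (K / n) ^ n := by
              gcongr
              rw [add_comm]
              exact Real.add_one_le_exp _
          _ = Real.exp K := by
              rw [← Real.exp_nat_mul, mul_div_cancel₀ _ hn0.ne']
      calc (1 + K / n) ^ n * (2 * K * (n : ℝ) ^ (q / 2 - 1) * 2 ^ q)
          ≤ Real.exp K * (2 * K * (n : ℝ) ^ (q / 2 - 1) * 2 ^ q) := by gcongr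
        _ = _ := by ring
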